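/- Let $n\ge 0$ be an integer and let $\mathbf R^{(n)}$ be the $n$-fold symmetric product of the real line, whose points are the divisors $\sum_i k_i x_i$ on $\mathbf R$ with integer multiplicities $k_i\ge 0$ and $\sum_i k_i=n$, with the quotient topology from $\mathbf R^n$. Let $S(n,1)\subset \mathbf R^{(n)}\times\mathbf R^{(n)}$ be the subspace of pairs of divisors with disjoint supports. Let $T(n,1)$ be the quotient space (with the quotient topology) of $S(n,1)$ by the equivalence relation that identifies two pairs $(D_0,D_1)$ and $(E_0,E_1)$ if, for $p=0,1$ and every $x\in\mathbf R$, the multiplicities of $x$ in $D_p$ and in $E_p$ are congruent modulo $2$. Then every connected component of $T(n,1)$ is contractible. -/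

import Mathlib

/-- The `n`-fold symmetric product of the real line: unordered `n`-tuples of real points counted
with multiplicity, i.e. effective divisors of degree `n` on `ℝ`. -/
def RealDivisor (n : ℕ) : Type := Sym ℝ n

namespace RealDivisor

/-- The multiplicity of the point `x` in the divisor `D`. -/
noncomputable def mult {n : ℕ} (D : RealDivisor n) (x : ℝ) : ℕ :=
  Multiset.count x D.1

/-- The support of a divisor: the points of positive multiplicity. -/
def support {n : ℕ} (D : RealDivisor n) : Set ℝ :=
  {x | 0 < D.mult x}

/-- The divisor `x₁ + ⋯ + xₙ` of an ordered `n`-tuple of real points. -/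
def ofTuple {n : ℕ} (x : Fin n → ℝ) : RealDivisor n :=
  ⟨Finset.univ.val.map x, by simp⟩

/-- The symmetric product carries the quotient topology from `ℝⁿ`. -/
instance (n : ℕ) : TopologicalSpace (RealDivisor n) :=
  TopologicalSpace.coinduced ofTuple inferInstance

end RealDivisor

/-- The space `S(n,m)` of `(m+1)`-tuples of real divisors of degree `n` on `ℝ` with no point common
to the supports of all `m+1` divisors, as a subspace of the `(m+1)`-fold Cartesian product. -/
abbrev DivisorCollection (n m : ℕ) : Type :=
  {D : Fin (m + 1) → RealDivisor n // ⋂ p, (D p).support = ∅}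

/-- Two collections of divisors are equivalent if all multiplicities agree modulo `2`. -/
def mod2Setoid (n m : ℕ) : Setoid (DivisorCollection n m) where
  r D E := ∀ (p : Fin (m + 1)) (x : ℝ), (D.1 p).mult x ≡ (E.1 p).mult x [MOD 2]
  iseqv :=
    { refl := fun _ _ _ => Nat.ModEq.refl _
      symm := fun h p x => (h p x).symm
      trans := fun h k p x => (h p x).trans (k p x) }

/-- The configuration space `T(n,m)` of mod 2 particles on the real line. -/
def ParticleSpace (n m : ℕ) : Type := Quotient (mod2Setoid n m)

/-- `T(n,m)` carries the quotient topology from `S(n,m)`. -/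
instance (n m : ℕ) : TopologicalSpace (ParticleSpace n m) :=
  inferInstanceAs (TopologicalSpace (Quotient (mod2Setoid n m)))

/-!
Read the particles of a configuration from left to right as a walk on `ℤ`, the Cayley graph of
`ℤ/2 * ℤ/2`: a particle of colour `p` crosses the edge labelled `p` at the current vertex. Two equal
neighbours retrace their steps, so the final vertex depends only on the configuration mod 2.

On the interval between two neighbouring particles, an edge is *active* if it separates the current
vertex from the final one. Let every particle travel to the right with unit speed, until it has
covered the total length of the intervals to its right on which its own edge is active. This closes
the gaps along each edge from right to left. Where a gap has been closed, its end points have merged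
and cancel mod 2. Particles of different colours that are not yet cancelled never collide, because
the sets of intervals on which two edges are active are nested as long as both are active.

At time `∞` the walk has become the geodesic from `0` to the final vertex. Its particles then move
along straight lines to the absolute values of their edges. What is left at the end depends only on
the order of the colours, so it is locally constant on the space of configurations.
-/

open Finset Topology unitInterval
open scoped ENNReal

section Topology

variable {X Y ι : Type*} [TopologicalSpace X]

lemma isLocallyConstant_of_finite_isClosed_cover [Finite ι] {f : X → Y} {A : ι → Set X}
    (hcover : ⋃ i, A i = Set.univ) (hclosed : ∀ i, IsClosed (A i))
    (hconst : ∀ i, ∀ x ∈ A i, ∀ y ∈ A i, f x = f y) : IsLocallyConstant f := by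
  let _ : TopologicalSpace Y := ⊥
  have : DiscreteTopology Y := ⟨rfl⟩
  refine (IsLocallyConstant.iff_continuous f).2 <|
    (locallyFinite_of_finite A).continuous hcover hclosed fun i => ?_
  rcases (A i).eq_empty_or_nonempty with hA | ⟨x, hx⟩
  · exact hA ▸ continuousOn_empty f
  · exact continuousOn_const.congr fun y hy => hconst i y hy x hx

lemma contractibleSpace_connectedComponent_of_isLocallyConstant {H : X → I → X}
    (hH : Continuous fun y : X × I => H y.1 y.2) (hzero : ∀ x, H x 0 = x)
    (hone : IsLocallyConstant fun x => H x 1) (x : X) :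
    ContractibleSpace (connectedComponent x) := by
  have hmem (y : connectedComponent x) (t : I) : H y t ∈ connectedComponent x := by
    have hrange : IsPreconnected (Set.range (H y)) :=
      isPreconnected_range (hH.comp (Continuous.prodMk_right y.1))
    exact (connectedComponent_eq y.2).ge (hrange.subset_connectedComponent ⟨0, hzero y⟩ ⟨t, rfl⟩)
  have hend (y : connectedComponent x) : H y 1 = H x 1 :=
    hone.apply_eq_of_isPreconnected isPreconnected_connectedComponent y.2 mem_connectedComponent
  rw [contractible_iff_id_nullhomotopic]
  exact ⟨⟨H x 1, hmem ⟨x, mem_connectedComponent⟩ 1⟩, ⟨{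
    toFun := fun y => ⟨H y.2 y.1, hmem y.2 y.1⟩
    continuous_toFun := by
      refine Continuous.subtype_mk ?_ _
      exact hH.comp ((continuous_subtype_val.comp continuous_snd).prodMk continuous_fst)
    map_zero_left := fun y => Subtype.ext (hzero y)
    map_one_left := fun y => Subtype.ext (hend y) }⟩⟩

end Topology

section Nat

lemma exists_not_and_succ {p : ℕ → Prop} {a b : ℕ} (hab : a ≤ b) (ha : ¬ p a) (hb : p b) :
    ∃ q, a ≤ q ∧ q < b ∧ ¬ p q ∧ p (q + 1) := by
  induction b, hab using Nat.le_induction with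
  | base => exact absurd hb ha
  | succ b hab ih =>
    by_cases hpb : p b
    · obtain ⟨q, haq, hqb, hq⟩ := ih hpb
      exact ⟨q, haq, hqb.trans b.lt_succ_self, hq⟩
    · exact ⟨b, hab, b.lt_succ_self, hpb, hb⟩

lemma exists_eq_range_of_isLowerSet {A : Finset ℕ} (hA : IsLowerSet (A : Set ℕ)) :
    ∃ m, A = range m := by
  rcases hA.eq_univ_or_Iio with hA | ⟨m, hA⟩
  · exact absurd (hA ▸ A.finite_toSet) Set.infinite_univ
  · exact ⟨m, coe_injective (by simpa using hA)⟩

lemma sum_Ico_mul_sub_succ {R : Type*} [CommRing R] (χ D : ℕ → R) {i M : ℕ} (hi : i ≤ M) :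
    ∑ q ∈ Ico i M, χ (q + 1) * (D (q + 1) - D q) =
      ∑ q ∈ Ico i M, (χ q - χ (q + 1)) * (D q - D i) + χ M * (D M - D i) := by
  induction M, hi using Nat.le_induction with
  | base => simp
  | succ M hi ih =>
    rw [sum_Ico_succ_top hi, sum_Ico_succ_top hi, ih]
    ring

end Nat

section Mod2Count

variable {ι κ μ ν : Type*}

lemma sum_smul_comp_eq_of_sum_fiber_eq [DecidableEq μ] {R M : Type*} [Semiring R] [AddCommMonoid M]
    [Module R M] {s : Finset ι} {t : Finset κ} {f : ι → μ} {g : κ → μ} {a : ι → R} {b : κ → R}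
    (h : ∀ y, ∑ i ∈ s with f i = y, a i = ∑ j ∈ t with g j = y, b j) (F : μ → M) :
    ∑ i ∈ s, a i • F (f i) = ∑ j ∈ t, b j • F (g j) := by
  rw [← sum_fiberwise_of_maps_to (g := f) (t := s.image f ∪ t.image g)
      fun i hi => mem_union_left _ (mem_image_of_mem f hi),
    ← sum_fiberwise_of_maps_to (g := g) (t := s.image f ∪ t.image g)
      fun j hj => mem_union_right _ (mem_image_of_mem g hj)]
  refine sum_congr rfl fun y _ => ?_
  calc ∑ i ∈ s with f i = y, a i • F (f i) = (∑ i ∈ s with f i = y, a i) • F y := by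
        rw [sum_smul]
        exact sum_congr rfl fun i hi => by rw [(mem_filter.1 hi).2]
    _ = ∑ j ∈ t with g j = y, b j • F (g j) := by
        rw [h y, sum_smul]
        exact sum_congr rfl fun j hj => by rw [(mem_filter.1 hj).2]

open Classical in
/-- The parity of the number of indices in `s` at which `f` takes the value `y`. Two families of
particles define the same mod 2 configuration when these parities agree for all `y`. -/
noncomputable def mod2Count (s : Finset ι) (f : ι → μ) (y : μ) : ZMod 2 :=
  #{i ∈ s | f i = y}

lemma mod2Count_eq_sum [DecidableEq μ] (s : Finset ι) (f : ι → μ) (y : μ) :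
    mod2Count s f y = ∑ i ∈ s, if f i = y then 1 else 0 := by
  rw [sum_boole, mod2Count]
  congr!

lemma mod2Count_congr {s : Finset ι} {f g : ι → μ} (h : ∀ i ∈ s, f i = g i) :
    mod2Count s f = mod2Count s g := by
  classical
  funext y
  simp only [mod2Count_eq_sum]
  exact sum_congr rfl fun i hi => by rw [h i hi]

lemma mod2Count_eq_zero_iff [DecidableEq μ] {s : Finset ι} {f : ι → μ} {y : μ} :
    mod2Count s f y = 0 ↔ Even #{i ∈ s | f i = y} := by
  rw [mod2Count_eq_sum, sum_boole, ZMod.natCast_eq_zero_iff_even]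

variable {s : Finset ι} {t : Finset κ} {f : ι → μ} {g : κ → μ}

lemma sum_comp_eq_of_mod2Count_eq (h : mod2Count s f = mod2Count t g) (F : μ → ZMod 2) :
    ∑ i ∈ s, F (f i) = ∑ j ∈ t, F (g j) := by
  classical
  simpa using sum_smul_comp_eq_of_sum_fiber_eq (R := ZMod 2) (a := 1) (b := 1) (F := F) fun y => by
    simpa [mod2Count_eq_sum, sum_boole] using congr_fun h y

lemma mod2Count_comp_eq (h : mod2Count s f = mod2Count t g) (φ : μ → ν) :
    mod2Count s (φ ∘ f) = mod2Count t (φ ∘ g) := by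
  classical
  funext y
  simpa only [mod2Count_eq_sum] using!
    sum_comp_eq_of_mod2Count_eq h fun z => if φ z = y then 1 else 0

lemma mod2Count_empty (f : ι → μ) : mod2Count ∅ f = 0 := by
  funext y
  simp [mod2Count]

lemma mod2Count_comp_eq_zero (h : mod2Count s f = 0) (φ : μ → ν) : mod2Count s (φ ∘ f) = 0 :=
  (mod2Count_comp_eq (h.trans (mod2Count_empty f).symm) φ).trans (mod2Count_empty _)

lemma mod2Count_univ_eq_of_eq_zero [Fintype ι] {f g : ι → μ} (hf : mod2Count s f = 0)
    (hg : mod2Count s g = 0) (h : ∀ i ∉ s, f i = g i) : mod2Count univ f = mod2Count univ g := by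
  classical
  funext y
  have hf := congr_fun hf y
  have hg := congr_fun hg y
  have hcompl := congr_fun (mod2Count_congr (s := sᶜ) fun i hi => h i (mem_compl.1 hi)) y
  rw [mod2Count_eq_sum] at hf hg hcompl ⊢
  rw [mod2Count_eq_sum] at hcompl ⊢
  rw [← sum_add_sum_compl s, hf, hcompl, ← hg, sum_add_sum_compl]

lemma mod2Count_map (e : ι ↪ κ) (g : κ → μ) : mod2Count (s.map e) g = mod2Count s (g ∘ e) := by
  classical
  funext y
  simp only [mod2Count_eq_sum, sum_map, Function.comp_apply]

end Mod2Count

section Travel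

/-- The distance covered by a particle that moves with unit speed for the time `T` and then stops,
or that stops earlier, when it has covered the distance `g`. -/
noncomputable def travel (T : ℝ≥0∞) (g : ℝ) : ℝ := (min T (ENNReal.ofReal g)).toReal

lemma continuous_travel : Continuous fun y : ℝ≥0∞ × ℝ => travel y.1 y.2 :=
  ENNReal.continuousOn_toReal.comp_continuous
    (continuous_fst.min (ENNReal.continuous_ofReal.comp continuous_snd))
    fun _ => ((min_le_right _ _).trans_lt ENNReal.ofReal_lt_top).ne

lemma travel_zero (g : ℝ) : travel 0 g = 0 := by simp [travel]

variable {T : ℝ≥0∞} {g g' : ℝ}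

lemma travel_eq_self (hg : 0 ≤ g) (h : ENNReal.ofReal g ≤ T) : travel T g = g := by
  rw [travel, min_eq_right h, ENNReal.toReal_ofReal hg]

lemma travel_le_self (hg : 0 ≤ g) : travel T g ≤ g :=
  (ENNReal.toReal_mono ENNReal.ofReal_ne_top (min_le_right _ _)).trans_eq
    (ENNReal.toReal_ofReal hg)

lemma travel_le_travel_of_le_ofReal (h : T ≤ ENNReal.ofReal g) : travel T g' ≤ travel T g :=
  ENNReal.toReal_mono ((min_le_right _ _).trans_lt ENNReal.ofReal_lt_top).ne <|
    le_min (min_le_left _ _) ((min_le_left _ _).trans h)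

end Travel

/-- The colours of a sequence of particles, listed from left to right. -/
abbrev ParticleWord : Type := ℕ → Fin 2

namespace ParticleWord

/-- The step of the walk on `ℤ` that is made at the `q`-th particle. Viewing `ℤ` as the Cayley graph
of the infinite dihedral group, with the edge between `m - 1` and `m` labelled by the generator
`m mod 2`, this is the step along the edge that is labelled by the colour of the particle. -/
def stepSign (c : ParticleWord) (q : ℕ) : ℤ := (-1) ^ (q + 1 + (c q : ℕ))

/-- The vertex that the walk has reached after `i` steps. -/
def height (c : ParticleWord) (i : ℕ) : ℤ := ∑ q ∈ range i, c.stepSign q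

/-- The edge used by the step at the `q`-th particle; the edge between `m - 1` and `m` is encoded by
its upper end `m`. -/
def edge (c : ParticleWord) (q : ℕ) : ℤ := max (c.height q) (c.height (q + 1))

/-- The edge `e` separates the vertices that the walk has reached after `q` and after `N` steps. -/
abbrev Separates (c : ParticleWord) (N : ℕ) (e : ℤ) (q : ℕ) : Prop :=
  ¬ (e ≤ c.height q ↔ e ≤ c.height N)

variable {c c' : ParticleWord} {N N' : ℕ} {e e' : ℤ} {q a b : ℕ}

lemma height_succ (c : ParticleWord) (q : ℕ) : c.height (q + 1) = c.height q + c.stepSign q :=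
  sum_range_succ _ _

lemma stepSign_cases (c : ParticleWord) (q : ℕ) :
    (c.stepSign q = 1 ∧ (q + c q) % 2 = 1) ∨ (c.stepSign q = -1 ∧ (q + c q) % 2 = 0) := by
  rw [stepSign, add_right_comm]
  rcases Nat.even_or_odd (q + c q + 1) with h | h
  · exact .inl ⟨h.neg_one_pow, by grind⟩
  · exact .inr ⟨h.neg_one_pow, by grind⟩

lemma edge_eq_height_add (c : ParticleWord) (q : ℕ) :
    c.edge q = c.height q + if (q + c q) % 2 = 1 then 1 else 0 := by
  have := c.height_succ q
  rcases c.stepSign_cases q with h | h <;> grind [edge]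

lemma edge_eq_or (c : ParticleWord) (q : ℕ) :
    (c.edge q = c.height q + 1 ∧ c.height (q + 1) = c.height q + 1) ∨
      (c.edge q = c.height q ∧ c.height (q + 1) = c.height q - 1) := by
  have := c.height_succ q
  rcases c.stepSign_cases q with h | h <;> grind [edge]

lemma height_emod_two (c : ParticleWord) (i : ℕ) : c.height i % 2 = i % 2 := by
  induction i with
  | zero => simp [height]
  | succ i ih => rcases c.edge_eq_or i with h | h <;> omega

/-- The label of the edge with upper end `e`. -/
def edgeColour (e : ℤ) : Fin 2 := if e % 2 = 0 then 0 else 1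

lemma edgeColour_edge (c : ParticleWord) (q : ℕ) : edgeColour (c.edge q) = c q := by
  have := c.edge_eq_height_add q
  have := c.height_emod_two q
  unfold edgeColour
  ext
  split_ifs <;> grind

lemma edge_ne_of_ne (h : c a ≠ c b) : c.edge a ≠ c.edge b := fun he =>
  h (by rw [← edgeColour_edge c a, he, edgeColour_edge])

lemma not_separates_self (c : ParticleWord) (N : ℕ) (e : ℤ) : ¬ c.Separates N e N :=
  not_not_intro Iff.rfl

lemma separates_succ_iff (h : c.edge q ≠ e) : c.Separates N e (q + 1) ↔ c.Separates N e q := by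
  rcases c.edge_eq_or q with hq | hq <;> grind

lemma separates_succ_edge : c.Separates N (c.edge q) (q + 1) ↔ ¬ c.Separates N (c.edge q) q := by
  rcases c.edge_eq_or q with hq | hq <;> grind

lemma sum_edge_eq_zero {P : ℕ → Prop} [DecidablePred P] {f : ℕ → ZMod 2}
    (hzero : P 0 → ¬ c.Separates N e 0)
    (hsucc : ∀ q, c.Separates N e (q + 1) → (P (q + 1) ↔ P q))
    (hf : ∀ q, q + 1 < N → P q → c.Separates N e (q + 1) → f (q + 1) = f q) :
    ∑ q ∈ range N with c.edge q = e ∧ P q, f q = 0 := by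
  let g (q : ℕ) : ZMod 2 := if P q ∧ c.Separates N e q then f q else 0
  have hterm : ∀ q ∈ range N, (if c.edge q = e ∧ P q then f q else 0) = g (q + 1) - g q := by
    intro q hq
    have hlt (hs : c.Separates N e (q + 1)) : q + 1 < N :=
      lt_of_le_of_ne (mem_range.1 hq) (by rintro rfl; exact not_separates_self _ _ _ hs)
    have hg (hP : P q) (hs : c.Separates N e (q + 1)) : g (q + 1) = f q := by
      rw [← hf q (hlt hs) hP hs]
      exact if_pos ⟨(hsucc q hs).2 hP, hs⟩
    by_cases he : c.edge q = e
    · have := separates_succ_edge (c := c) (N := N) (q := q)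
      rw [he] at this
      have := ZMod.neg_eq_self_mod_two (f q)
      grind
    · have := separates_succ_iff (N := N) he
      grind
  rw [sum_filter, sum_congr rfl hterm, sum_range_sub]
  have hN : g N = 0 := if_neg fun h => not_separates_self c N e h.2
  have h0 : g 0 = 0 := if_neg fun h => hzero h.1 h.2
  rw [hN, h0, sub_zero]

/-- The particles `0, …, N - 1` with colours `c` and places `x` are listed from left to right, and
particles of different colours are at different places. -/
structure Sorted (c : ParticleWord) (x : ℕ → ℝ) (N : ℕ) : Prop where
  mono : ∀ a b, a ≤ b → b < N → x a ≤ x b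
  lt : ∀ a b, a < b → b < N → c a ≠ c b → x a < x b

/-- The total length of the intervals to the right of the `i`-th particle on which `e` separates
the current vertex of the walk from the final one. -/
noncomputable def gapLength (c : ParticleWord) (x : ℕ → ℝ) (N : ℕ) (e : ℤ) (i : ℕ) : ℝ :=
  ∑ q ∈ Ico i N, if c.Separates N e (q + 1) then x (q + 1) - x q else 0

variable {x x' : ℕ → ℝ} {s : ℝ} {T : ℝ≥0∞}

lemma gapLength_of_separates (hq : q < N) (hs : c.Separates N e (q + 1)) :
    c.gapLength x N e q = x (q + 1) - x q + c.gapLength x N e (q + 1) := by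
  rw [gapLength, sum_eq_sum_Ico_succ_bot hq, if_pos hs, gapLength]

lemma gapLength_of_not_separates (hq : q < N) (hs : ¬ c.Separates N e (q + 1)) :
    c.gapLength x N e q = c.gapLength x N e (q + 1) := by
  rw [gapLength, sum_eq_sum_Ico_succ_bot hq, if_neg hs, zero_add, gapLength]

lemma lt_of_separates_succ (hq : q < N) (hs : c.Separates N e (q + 1)) : q + 1 < N :=
  lt_of_le_of_ne hq fun h => not_separates_self c N e (h ▸ hs)

namespace Sorted

lemma ite_separates_nonneg (h : c.Sorted x N) (hq : q < N) (e : ℤ) :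
    0 ≤ if c.Separates N e (q + 1) then x (q + 1) - x q else 0 := by
  split_ifs with hs
  · exact sub_nonneg.2 (h.mono q (q + 1) q.le_succ (lt_of_separates_succ hq hs))
  · rfl

lemma gapLength_nonneg (h : c.Sorted x N) (e : ℤ) (i : ℕ) : 0 ≤ c.gapLength x N e i :=
  sum_nonneg fun _ hq => h.ite_separates_nonneg (mem_Ico.1 hq).2 e

lemma gapLength_anti (h : c.Sorted x N) (e : ℤ) (hab : a ≤ b) :
    c.gapLength x N e b ≤ c.gapLength x N e a :=
  sum_le_sum_of_subset_of_nonneg (Ico_subset_Ico_left hab) fun _ hq _ =>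
    h.ite_separates_nonneg (mem_Ico.1 hq).2 e

lemma gapLength_le_sub_add (h : c.Sorted x N) (e : ℤ) (hab : a ≤ b) (hb : b < N) :
    c.gapLength x N e a ≤ x b - x a + c.gapLength x N e b := by
  induction b, hab using Nat.le_induction with
  | base => simp
  | succ b _ ih =>
    have hmono := h.mono b (b + 1) b.le_succ hb
    have ih := ih (by omega)
    by_cases hs : c.Separates N e (b + 1)
    · linarith [gapLength_of_separates (x := x) (by omega) hs]
    · linarith [gapLength_of_not_separates (x := x) (by omega) hs]

lemma gapLength_mono (h : c.Sorted x N) (hee : ∀ q, c.Separates N e q → c.Separates N e' q)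
    (i : ℕ) : c.gapLength x N e i ≤ c.gapLength x N e' i := by
  refine sum_le_sum fun q hq => ?_
  by_cases hs : c.Separates N e (q + 1)
  · rw [if_pos hs, if_pos (hee _ hs)]
  · rw [if_neg hs]
    exact h.ite_separates_nonneg (mem_Ico.1 hq).2 e'

end Sorted

/-- At time `T`, the first of the gaps along the edge `e` that begin before the `i`-th particle, or
at it, has been closed; gaps close in the order from right to left. -/
def Cancelled (c : ParticleWord) (x : ℕ → ℝ) (N : ℕ) (T : ℝ≥0∞) (e : ℤ) (i : ℕ) : Prop :=
  ∃ a ≤ i, ¬ c.Separates N e a ∧ ENNReal.ofReal (c.gapLength x N e a) < T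

lemma cancelled_succ_iff (hs : c.Separates N e (q + 1)) :
    c.Cancelled x N T e (q + 1) ↔ c.Cancelled x N T e q := by
  constructor
  · rintro ⟨a, ha, hna, hT⟩
    refine ⟨a, ?_, hna, hT⟩
    by_contra! hqa
    exact hna (by rwa [show a = q + 1 by omega])
  · rintro ⟨a, ha, h⟩
    exact ⟨a, by omega, h⟩

lemma Cancelled.not_separates_zero (h : c.Cancelled x N T e 0) : ¬ c.Separates N e 0 := by
  obtain ⟨a, ha, hna, -⟩ := h
  rwa [Nat.le_zero.1 ha] at hna

namespace Sorted

lemma add_travel_lt_of_not_separates (h : c.Sorted x N) {r : ℕ} (har : a ≤ r) (hrb : r < b)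
    (hb : b < N) (hc : c a ≠ c b) (hr : ¬ c.Separates N (c.edge b) r)
    (hsb : c.Separates N (c.edge b) b) (hnc : ¬ c.Cancelled x N T (c.edge b) b) :
    x a + travel T (c.gapLength x N (c.edge a) a) < x b + c.gapLength x N (c.edge b) b := by
  obtain ⟨q, hrq, hqb, hq, hsq⟩ : ∃ q, r ≤ q ∧ q < b ∧ ¬ c.Separates N (c.edge b) q ∧
      c.Separates N (c.edge b) (q + 1) :=
    exists_not_and_succ hrb.le hr hsb
  have hedge : c.edge q = c.edge b := by
    by_contra hne
    exact hq ((separates_succ_iff hne).1 hsq)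
  have hcq : c q = c b := by rw [← edgeColour_edge c q, hedge, edgeColour_edge]
  have haq : a < q := lt_of_le_of_ne (har.trans hrq) (by rintro rfl; exact hc hcq)
  have hlt : x a < x q := h.lt a q haq (hqb.trans hb) (hcq ▸ hc)
  have hT : T ≤ ENNReal.ofReal (c.gapLength x N (c.edge b) q) :=
    not_lt.1 fun hlt => hnc ⟨q, hqb.le, hq, hlt⟩
  calc x a + travel T (c.gapLength x N (c.edge a) a)
      < x q + travel T (c.gapLength x N (c.edge b) q) :=
        add_lt_add_of_lt_of_le hlt (travel_le_travel_of_le_ofReal hT)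
    _ ≤ x q + c.gapLength x N (c.edge b) q := by
        gcongr
        exact travel_le_self (h.gapLength_nonneg _ _)
    _ ≤ x b + c.gapLength x N (c.edge b) b := by
        linarith [h.gapLength_le_sub_add (c.edge b) hqb.le hb]

lemma add_gapLength_lt_of_separates (h : c.Sorted x N) (hab : a < b) (hb : b < N)
    (hc : c a ≠ c b) (hs : ∀ r, a ≤ r → r ≤ b → c.Separates N (c.edge b) r) :
    x a + c.gapLength x N (c.edge a) a < x b + c.gapLength x N (c.edge b) b := by
  obtain ⟨d, rfl⟩ : ∃ d, b = d + 1 := ⟨b - 1, by omega⟩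
  have hsa := hs a le_rfl hab.le
  have hsa' := hs (a + 1) (by omega) (by omega)
  have hsd := hs d (by omega) (by omega)
  have hsb := hs (d + 1) (by omega) le_rfl
  have hne := edge_ne_of_ne hc
  have hedge := c.edge_eq_or a
  have hnest (q : ℕ) (hq : c.Separates N (c.edge a) q) : c.Separates N (c.edge (d + 1)) q := by
    grind
  have hnot : ¬ c.Separates N (c.edge a) (d + 1) := by
    have := c.edge_eq_or (d + 1)
    grind
  have hcd : c d ≠ c (d + 1) := by
    intro hcd
    have := c.edge_eq_or d
    have := c.edge_eq_or (d + 1)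
    have := c.edge_eq_height_add d
    have := c.edge_eq_height_add (d + 1)
    grind
  have hlt : x d < x (d + 1) := h.lt d (d + 1) d.lt_succ_self hb hcd
  calc x a + c.gapLength x N (c.edge a) a
      ≤ x d + c.gapLength x N (c.edge a) d := by
        linarith [h.gapLength_le_sub_add (c.edge a) (show a ≤ d by omega) (by omega)]
    _ = x d + c.gapLength x N (c.edge a) (d + 1) := by
        rw [gapLength_of_not_separates (by omega) hnot]
    _ < x (d + 1) + c.gapLength x N (c.edge a) (d + 1) := by gcongr
    _ ≤ x (d + 1) + c.gapLength x N (c.edge (d + 1)) (d + 1) := by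
        gcongr
        exact h.gapLength_mono hnest _

lemma add_travel_lt (h : c.Sorted x N) (hab : a < b) (hb : b < N) (hc : c a ≠ c b)
    (hnc : ¬ c.Cancelled x N T (c.edge b) b) :
    x a + travel T (c.gapLength x N (c.edge a) a) <
      x b + travel T (c.gapLength x N (c.edge b) b) := by
  rcases le_or_gt T (ENNReal.ofReal (c.gapLength x N (c.edge b) b)) with hT | hT
  · exact add_lt_add_of_lt_of_le (h.lt a b hab hb hc) (travel_le_travel_of_le_ofReal hT)
  have hsb : c.Separates N (c.edge b) b := by
    by_contra hs
    exact hnc ⟨b, le_rfl, not_not_intro hs, hT⟩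
  rw [travel_eq_self (h.gapLength_nonneg _ _) hT.le]
  by_cases hall : ∀ r, a ≤ r → r ≤ b → c.Separates N (c.edge b) r
  · have hlt := h.add_gapLength_lt_of_separates hab hb hc hall
    linarith [travel_le_self (T := T) (h.gapLength_nonneg (c.edge a) a)]
  · push Not at hall
    obtain ⟨r, har, hrb, hr⟩ := hall
    exact h.add_travel_lt_of_not_separates har
      (lt_of_le_of_ne hrb (by rintro rfl; exact hsb hr)) hb hc (not_not_intro hr) hsb hnc

end Sorted

lemma separates_of_not_cancelled_top (h : ¬ c.Cancelled x N ⊤ e a) (hq : q ≤ a) :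
    c.Separates N e q := by
  by_contra hs
  exact h ⟨q, hq, not_not_intro hs, ENNReal.ofReal_lt_top⟩

lemma abs_edge_lt (hab : a < b) (ha : ¬ c.Cancelled x N ⊤ (c.edge a) a)
    (hb : ¬ c.Cancelled x N ⊤ (c.edge b) b) : |c.edge a| < |c.edge b| := by
  have ha0 := separates_of_not_cancelled_top ha a.zero_le
  have := separates_of_not_cancelled_top hb b.zero_le
  have haa := separates_of_not_cancelled_top ha le_rfl
  have hba := separates_of_not_cancelled_top hb hab.le
  have hba' := separates_of_not_cancelled_top hb hab
  have hzero : c.height 0 = 0 := sum_range_zero _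
  rcases c.edge_eq_or a with h | h <;> grind

/-- The position of a particle that starts at `y`, travels to the right for the time `T`, but at
most for the distance `g`, and has then covered the fraction `s` of the way to `|e|`. -/
noncomputable def destination (T : ℝ≥0∞) (s y g : ℝ) (e : ℤ) : ℝ :=
  (1 - s) * (y + travel T g) + s * |(e : ℝ)|

/-- The position of the `q`-th particle during the contraction. -/
noncomputable def moved (c : ParticleWord) (x : ℕ → ℝ) (N : ℕ) (T : ℝ≥0∞) (s : ℝ) (q : ℕ) : ℝ :=
  destination T s (x q) (c.gapLength x N (c.edge q) q) (c.edge q)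

lemma moved_zero_zero (c : ParticleWord) (x : ℕ → ℝ) (N : ℕ) : c.moved x N 0 0 = x := by
  funext q
  simp [moved, destination, travel_zero]

lemma moved_one (c : ParticleWord) (x : ℕ → ℝ) (N : ℕ) (T : ℝ≥0∞) :
    c.moved x N T 1 = fun q => |(c.edge q : ℝ)| := by
  funext q
  simp [moved, destination]

namespace Sorted

lemma moved_lt (h : c.Sorted x N) (hs0 : 0 ≤ s) (hs1 : s ≤ 1) (hTs : s = 0 ∨ T = ⊤)
    (hab : a < b) (hb : b < N) (hc : c a ≠ c b) (hna : ¬ c.Cancelled x N T (c.edge a) a)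
    (hnb : ¬ c.Cancelled x N T (c.edge b) b) : c.moved x N T s a < c.moved x N T s b := by
  have hflow := h.add_travel_lt hab hb hc hnb
  rcases hTs with rfl | rfl
  · simpa [moved, destination] using hflow
  · have habs : |(c.edge a : ℝ)| < |(c.edge b : ℝ)| := by exact_mod_cast abs_edge_lt hab hna hnb
    unfold moved destination
    rcases hs1.lt_or_eq with hs1 | rfl
    · have := sub_pos.2 hs1
      exact add_lt_add_of_lt_of_le (mul_lt_mul_of_pos_left hflow this)
        (mul_le_mul_of_nonneg_left habs.le hs0)
    · simpa using habs

lemma moved_ne (h : c.Sorted x N) (hs0 : 0 ≤ s) (hs1 : s ≤ 1) (hTs : s = 0 ∨ T = ⊤)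
    (ha : a < N) (hb : b < N) (hc : c a ≠ c b) (hna : ¬ c.Cancelled x N T (c.edge a) a)
    (hnb : ¬ c.Cancelled x N T (c.edge b) b) : c.moved x N T s a ≠ c.moved x N T s b := by
  rcases lt_trichotomy a b with hab | rfl | hba
  · exact (h.moved_lt hs0 hs1 hTs hab hb hc hna hnb).ne
  · exact absurd rfl hc
  · exact (h.moved_lt hs0 hs1 hTs hba ha hc.symm hnb hna).ne'

lemma add_travel_succ_eq (h : c.Sorted x N) (hq : q < N) (hs : c.Separates N e (q + 1))
    (hT : ENNReal.ofReal (c.gapLength x N e q) ≤ T) :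
    x (q + 1) + travel T (c.gapLength x N e (q + 1)) = x q + travel T (c.gapLength x N e q) := by
  have hT' := (ENNReal.ofReal_le_ofReal (h.gapLength_anti e q.le_succ)).trans hT
  rw [travel_eq_self (h.gapLength_nonneg e q) hT, travel_eq_self (h.gapLength_nonneg e _) hT',
    gapLength_of_separates hq hs]
  ring

lemma mod2Count_edge_moved_eq_zero (h : c.Sorted x N) {x₀ : ℕ → ℝ} {T₀ : ℝ≥0∞}
    (hT : ∀ q < N, ∀ a < N, ENNReal.ofReal (c.gapLength x₀ N (c.edge q) a) < T₀ →
      ENNReal.ofReal (c.gapLength x N (c.edge q) a) ≤ T)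
    {S : Finset ℕ} (hS : ∀ q, q ∈ S ↔ q < N ∧ c.Cancelled x₀ N T₀ (c.edge q) q) :
    mod2Count S (fun q => (c.edge q, c.moved x N T s q)) = 0 := by
  classical
  funext ⟨e, w⟩
  let f (q : ℕ) : ZMod 2 := if destination T s (x q) (c.gapLength x N e q) e = w then 1 else 0
  have hsum : mod2Count S (fun q => (c.edge q, c.moved x N T s q)) (e, w) =
      ∑ q ∈ range N with c.edge q = e ∧ c.Cancelled x₀ N T₀ e q, f q := by
    have hfilter : {q ∈ range N | c.edge q = e ∧ c.Cancelled x₀ N T₀ e q} =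
        {q ∈ S | c.edge q = e} := by
      ext q
      grind
    rw [mod2Count_eq_sum, hfilter, sum_filter]
    refine sum_congr rfl fun q _ => ?_
    by_cases hq : c.edge q = e
    · simp [f, moved, hq]
    · simp [hq]
  rw [hsum]
  by_cases he : ∃ r < N, c.edge r = e
  · obtain ⟨r, hr, rfl⟩ := he
    refine sum_edge_eq_zero Cancelled.not_separates_zero (fun q hs => cancelled_succ_iff hs) ?_
    rintro q hq ⟨a, haq, -, ha⟩ hs
    have hqT : ENNReal.ofReal (c.gapLength x N (c.edge r) q) ≤ T :=
      (ENNReal.ofReal_le_ofReal (h.gapLength_anti _ haq)).trans (hT r hr a (by omega) ha)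
    refine congrArg (fun z => if z = w then 1 else 0) ?_
    rw [destination, destination, h.add_travel_succ_eq (by omega) hs hqT]
  · refine sum_eq_zero fun q hq => ?_
    exact absurd ⟨q, mem_range.1 (mem_filter.1 hq).1, (mem_filter.1 hq).2.1⟩ he

lemma mod2Count_moved_eq_zero (h : c.Sorted x N) {x₀ : ℕ → ℝ} {T₀ : ℝ≥0∞}
    (hT : ∀ q < N, ∀ a < N, ENNReal.ofReal (c.gapLength x₀ N (c.edge q) a) < T₀ →
      ENNReal.ofReal (c.gapLength x N (c.edge q) a) ≤ T)
    {S : Finset ℕ} (hS : ∀ q, q ∈ S ↔ q < N ∧ c.Cancelled x₀ N T₀ (c.edge q) q) :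
    mod2Count S (fun q => (c q, c.moved x N T s q)) = 0 := by
  simpa only [Function.comp_def, edgeColour_edge] using
    mod2Count_comp_eq_zero (h.mod2Count_edge_moved_eq_zero (s := s) hT hS)
      fun y => (edgeColour y.1, y.2)

end Sorted

/-- The number of particles to the left of `w`. -/
noncomputable def before (x : ℕ → ℝ) (N : ℕ) (w : ℝ) : ℕ := #{q ∈ range N | x q < w}

namespace Sorted

lemma filter_lt_eq_range (h : c.Sorted x N) (w : ℝ) :
    {q ∈ range N | x q < w} = range (before x N w) := by
  obtain ⟨m, hm⟩ : ∃ m, {q ∈ range N | x q < w} = range m := by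
    refine exists_eq_range_of_isLowerSet fun a b hba ha => ?_
    have := h.mono b a hba
    grind
  rw [before, hm, card_range]

lemma exists_filter_eq_eq_Ico (h : c.Sorted x N) (w : ℝ) :
    ∃ m, {q ∈ range N | x q = w} = Ico (before x N w) m := by
  obtain ⟨m, hm⟩ : ∃ m, {q ∈ range N | x q ≤ w} = range m := by
    refine exists_eq_range_of_isLowerSet fun a b hba ha => ?_
    have := h.mono b a hba
    grind
  refine ⟨m, ?_⟩
  have hlt := h.filter_lt_eq_range w
  ext q
  have h1 := Finset.ext_iff.1 hm q
  have h2 := Finset.ext_iff.1 hlt q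
  grind

lemma colour_eq_of_place_eq (h : c.Sorted x N) (ha : a < N) (hb : b < N) (hab : x a = x b) :
    c a = c b := by
  by_contra hc
  rcases lt_trichotomy a b with hlt | rfl | hlt
  · exact (h.lt a b hlt hb hc).ne hab
  · exact hc rfl
  · exact (h.lt b a hlt ha (Ne.symm hc)).ne' hab

lemma exists_fiber_eq_Ico (h : c.Sorted x N) (p : Fin 2) (w : ℝ) :
    ∃ m, {q ∈ range N | (c q, x q) = (p, w)} = Ico (before x N w) m := by
  rcases eq_empty_or_nonempty {q ∈ range N | (c q, x q) = (p, w)} with hempty | ⟨q₀, hq₀⟩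
  · exact ⟨0, by rw [hempty, Ico_eq_empty_of_le (Nat.zero_le _)]⟩
  · obtain ⟨m, hm⟩ := h.exists_filter_eq_eq_Ico w
    refine ⟨m, hm ▸ ?_⟩
    ext q
    have := h.colour_eq_of_place_eq (a := q) (b := q₀)
    grind

lemma sum_stepSign_fiber (h : c.Sorted x N) (p : Fin 2) (w : ℝ) :
    ∑ q ∈ range N with (c q, x q) = (p, w), c.stepSign q =
      if Even #{q ∈ range N | (c q, x q) = (p, w)} then 0 else (-1) ^ (before x N w + 1 + p) := by
  obtain ⟨m, hm⟩ := h.exists_fiber_eq_Ico p w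
  have hsign (q : ℕ) (hq : q ∈ {q ∈ range N | (c q, x q) = (p, w)}) :
      c.stepSign q = (-1) ^ q * (-1) ^ (1 + (p : ℕ)) := by
    have hcq : c q = p := (Prod.ext_iff.1 (mem_filter.1 hq).2).1
    rw [stepSign, hcq, add_assoc, pow_add]
  rw [sum_congr rfl hsign, ← sum_mul, hm, sum_Ico_eq_sum_range, Nat.card_Ico]
  simp only [pow_add, ← mul_sum, neg_one_geom_sum]
  split_ifs <;> ring

end Sorted

section Invariance

lemma even_before_iff (hp : mod2Count (range N) (fun q => (c q, x q)) =
    mod2Count (range N') fun q => (c' q, x' q)) (w : ℝ) :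
    Even (before x N w) ↔ Even (before x' N' w) := by
  have hsum := sum_comp_eq_of_mod2Count_eq hp fun y => if y.2 < w then 1 else 0
  simp only [sum_boole] at hsum
  rw [before, before, ← ZMod.natCast_eq_zero_iff_even, hsum, ZMod.natCast_eq_zero_iff_even]

namespace Sorted

lemma sum_stepSign_smul_eq {M : Type*} [AddCommGroup M] (h : c.Sorted x N) (h' : c'.Sorted x' N')
    (hp : mod2Count (range N) (fun q => (c q, x q)) =
      mod2Count (range N') fun q => (c' q, x' q)) (F : Fin 2 × ℝ → M) :
    ∑ q ∈ range N, c.stepSign q • F (c q, x q) =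
      ∑ q ∈ range N', c'.stepSign q • F (c' q, x' q) := by
  refine sum_smul_comp_eq_of_sum_fiber_eq (fun ⟨p, w⟩ => ?_) F
  have hcard : Even #{q ∈ range N | (c q, x q) = (p, w)} ↔
      Even #{q ∈ range N' | (c' q, x' q) = (p, w)} := by
    rw [← mod2Count_eq_zero_iff, hp, mod2Count_eq_zero_iff]
  have hpow : (-1 : ℤ) ^ before x N w = (-1) ^ before x' N' w :=
    neg_one_pow_congr (even_before_iff hp w)
  rw [h.sum_stepSign_fiber, h'.sum_stepSign_fiber, if_congr hcard rfl rfl, add_assoc, add_assoc,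
    pow_add, pow_add _ (before x' N' w), hpow]

lemma height_eq (h : c.Sorted x N) (h' : c'.Sorted x' N')
    (hp : mod2Count (range N) (fun q => (c q, x q)) =
      mod2Count (range N') fun q => (c' q, x' q)) : c.height N = c'.height N' := by
  simpa [height] using h.sum_stepSign_smul_eq h' hp fun _ => (1 : ℤ)

end Sorted

end Invariance

/-- The edge that is crossed by a particle of colour `y.1` at `y.2`, in terms of the particles to
the left of `y.2`. -/
noncomputable def edgeAt (c : ParticleWord) (x : ℕ → ℝ) (N : ℕ) (y : Fin 2 × ℝ) : ℤ :=
  c.height (before x N y.2) + if (before x N y.2 + y.1) % 2 = 1 then 1 else 0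

/-- The total length of the gaps along the edge `e` to the right of `w`, as a signed sum over the
particles that cross `e`. -/
noncomputable def gapSum (c : ParticleWord) (x : ℕ → ℝ) (N : ℕ) (e : ℤ) (w : ℝ) : ℝ :=
  (if e ≤ c.height N then 1 else -1) *
    ∑ q ∈ range N, c.stepSign q • if c.edgeAt x N (c q, x q) = e then max (x q - w) 0 else 0

lemma edge_succ_of_colour_eq (h : c (q + 1) = c q) : c.edge (q + 1) = c.edge q := by
  have := c.edge_eq_height_add q
  have := c.edge_eq_height_add (q + 1)
  have := c.edge_eq_or q
  grind

lemma Sorted.edge_eq_edgeAt (h : c.Sorted x N) (hq : q < N) :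
    c.edge q = c.edgeAt x N (c q, x q) := by
  have hlt := h.filter_lt_eq_range (x q)
  have hbq : before x N (x q) ≤ q := by
    have := Finset.ext_iff.1 hlt q
    grind
  have hcolour (r : ℕ) (hbr : before x N (x q) ≤ r) (hrq : r ≤ q) : c r = c q := by
    have := Finset.ext_iff.1 hlt r
    have := h.mono r q hrq hq
    exact h.colour_eq_of_place_eq (by omega) hq (by grind)
  have hedge (r : ℕ) (hbr : before x N (x q) ≤ r) (hrq : r ≤ q) :
      c.edge r = c.edge (before x N (x q)) := by
    induction r, hbr using Nat.le_induction with
    | base => rfl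
    | succ r hbr ih =>
      rw [← ih (by omega)]
      exact edge_succ_of_colour_eq
        ((hcolour (r + 1) (by omega) hrq).trans (hcolour r hbr (by omega)).symm)
  rw [hedge q hbq le_rfl, edge_eq_height_add, hcolour _ le_rfl hbq, edgeAt]

lemma ite_separates_sub_ite_separates_succ (c : ParticleWord) (N : ℕ) (e : ℤ) (q : ℕ) :
    ((if c.Separates N e q then 1 else 0) - if c.Separates N e (q + 1) then 1 else 0 : ℝ) =
      (if e ≤ c.height N then 1 else -1) * if c.edge q = e then (c.stepSign q : ℝ) else 0 := by
  have := c.height_succ q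
  have hedge := c.edge_eq_height_add q
  rcases c.stepSign_cases q with ⟨h, hpar⟩ | ⟨h, hpar⟩
  · have hcast : (c.stepSign q : ℝ) = 1 := by simp [h]
    grind
  · have hcast : (c.stepSign q : ℝ) = -1 := by simp [h]
    grind

lemma Sorted.gapLength_eq_gapSum (h : c.Sorted x N) {i : ℕ} (hi : i < N) (e : ℤ) :
    c.gapLength x N e i = c.gapSum x N e (x i) := by
  let χ (q : ℕ) : ℝ := if c.Separates N e q then 1 else 0
  have hχN : χ N = 0 := if_neg (not_separates_self c N e)
  have hsub : Ico i N ⊆ range N := fun q hq => mem_range.2 (mem_Ico.1 hq).2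
  calc c.gapLength x N e i = ∑ q ∈ Ico i N, χ (q + 1) * (x (q + 1) - x q) := by
        simp only [gapLength, χ, ite_mul, one_mul, zero_mul]
    _ = ∑ q ∈ Ico i N, (χ q - χ (q + 1)) * (x q - x i) := by
        rw [sum_Ico_mul_sub_succ χ x hi.le, hχN, zero_mul, add_zero]
    _ = ∑ q ∈ Ico i N, (χ q - χ (q + 1)) * max (x q - x i) 0 := by
        refine sum_congr rfl fun q hq => ?_
        have hq := mem_Ico.1 hq
        rw [max_eq_left (sub_nonneg.2 (h.mono i q hq.1 hq.2))]
    _ = ∑ q ∈ range N, (χ q - χ (q + 1)) * max (x q - x i) 0 := by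
        refine sum_subset hsub fun q hq hqi => ?_
        have hqi : q ≤ i := by simp at hq hqi; omega
        rw [max_eq_right (sub_nonpos.2 (h.mono q i hqi hi)), mul_zero]
    _ = c.gapSum x N e (x i) := by
        rw [gapSum, mul_sum]
        refine sum_congr rfl fun q hq => ?_
        rw [ite_separates_sub_ite_separates_succ, h.edge_eq_edgeAt (mem_range.1 hq), zsmul_eq_mul]
        split_ifs <;> ring

section Invariance

namespace Sorted

lemma edgeAt_eq (h : c.Sorted x N) (h' : c'.Sorted x' N')
    (hp : mod2Count (range N) (fun q => (c q, x q)) =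
      mod2Count (range N') fun q => (c' q, x' q)) : c.edgeAt x N = c'.edgeAt x' N' := by
  funext ⟨p, w⟩
  have hheight : c.height (before x N w) = c'.height (before x' N' w) := by
    simpa [height, ← h.filter_lt_eq_range, ← h'.filter_lt_eq_range, sum_filter] using
      h.sum_stepSign_smul_eq h' hp fun y => if y.2 < w then (1 : ℤ) else 0
  have := even_before_iff hp w
  simp only [edgeAt, hheight]
  grind

lemma gapSum_eq (h : c.Sorted x N) (h' : c'.Sorted x' N')
    (hp : mod2Count (range N) (fun q => (c q, x q)) =
      mod2Count (range N') fun q => (c' q, x' q)) : c.gapSum x N = c'.gapSum x' N' := by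
  funext e w
  rw [gapSum, gapSum, h.height_eq h' hp, h.edgeAt_eq h' hp]
  congr 1
  exact h.sum_stepSign_smul_eq h' hp fun y =>
    if c'.edgeAt x' N' y = e then max (y.2 - w) 0 else 0

lemma moved_eq (h : c.Sorted x N) (T : ℝ≥0∞) (s : ℝ) (hq : q < N) :
    c.moved x N T s q = destination T s (x q)
      (c.gapSum x N (c.edgeAt x N (c q, x q)) (x q)) (c.edgeAt x N (c q, x q)) := by
  rw [moved, h.gapLength_eq_gapSum hq, h.edge_eq_edgeAt hq]

lemma mod2Count_moved_eq (h : c.Sorted x N) (h' : c'.Sorted x' N')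
    (hp : mod2Count (range N) (fun q => (c q, x q)) =
      mod2Count (range N') fun q => (c' q, x' q)) (T : ℝ≥0∞) (s : ℝ) :
    mod2Count (range N) (fun q => (c q, c.moved x N T s q)) =
      mod2Count (range N') fun q => (c' q, c'.moved x' N' T s q) := by
  let φ (y : Fin 2 × ℝ) : Fin 2 × ℝ :=
    (y.1, destination T s y.2 (c.gapSum x N (c.edgeAt x N y) y.2) (c.edgeAt x N y))
  have hφ : mod2Count (range N) (fun q => (c q, c.moved x N T s q)) =
      mod2Count (range N) (φ ∘ fun q => (c q, x q)) :=
    mod2Count_congr fun q hq => by rw [h.moved_eq T s (mem_range.1 hq)]; rfl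
  have hφ' : mod2Count (range N') (fun q => (c' q, c'.moved x' N' T s q)) =
      mod2Count (range N') (φ ∘ fun q => (c' q, x' q)) :=
    mod2Count_congr fun q hq => by
      rw [h'.moved_eq T s (mem_range.1 hq), ← h.gapSum_eq h' hp, ← h.edgeAt_eq h' hp]; rfl
  rw [hφ, hφ', mod2Count_comp_eq hp φ]

end Sorted

end Invariance

end ParticleWord

namespace RealDivisor

variable {n : ℕ}

lemma mult_ofTuple (x : Fin n → ℝ) (w : ℝ) : (ofTuple x).mult w = #{i | x i = w} := by
  simp only [mult, ofTuple, Multiset.count_map, card_def, filter_val, eq_comm]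

lemma mem_support_ofTuple {x : Fin n → ℝ} {w : ℝ} : w ∈ (ofTuple x).support ↔ ∃ i, x i = w := by
  simp [support, mult_ofTuple, card_pos, Finset.Nonempty]

lemma ofTuple_comp_perm (x : Fin n → ℝ) (e : Equiv.Perm (Fin n)) :
    ofTuple (x ∘ e) = ofTuple x := by
  refine Subtype.ext ?_
  simpa only [ofTuple, Fin.univ_val_map, Multiset.coe_eq_coe] using e.ofFn_comp_perm x

lemma ofTuple_eq_iff {x y : Fin n → ℝ} :
    ofTuple x = ofTuple y ↔ ∃ e : Equiv.Perm (Fin n), x ∘ e = y := by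
  constructor
  · intro h
    have hperm : (List.ofFn (x ∘ Tuple.sort x)).Perm (List.ofFn (y ∘ Tuple.sort y)) := by
      rw [← ofTuple_comp_perm x (Tuple.sort x), ← ofTuple_comp_perm y (Tuple.sort y)] at h
      simpa only [ofTuple, Fin.univ_val_map, Multiset.coe_eq_coe] using congrArg Subtype.val h
    have hsort : x ∘ Tuple.sort x = y ∘ Tuple.sort y := List.ofFn_injective <|
      hperm.eq_of_pairwise' (Tuple.monotone_sort x).sortedLE_ofFn.pairwise
        (Tuple.monotone_sort y).sortedLE_ofFn.pairwise
    refine ⟨(Tuple.sort y).symm.trans (Tuple.sort x), funext fun i => ?_⟩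
    simpa using congr_fun hsort ((Tuple.sort y).symm i)
  · rintro ⟨e, rfl⟩
    exact (ofTuple_comp_perm x e).symm

lemma ofTuple_surjective : Function.Surjective (ofTuple (n := n)) := by
  rintro ⟨s, rfl⟩
  induction s using Quotient.inductionOn with
  | h l =>
    exact ⟨l.get, Subtype.ext <| (Fin.univ_val_map _).trans <| congrArg _ (List.ofFn_get l)⟩

lemma isOpenQuotientMap_ofTuple : IsOpenQuotientMap (ofTuple (n := n)) where
  surjective := ofTuple_surjective
  continuous := continuous_coinduced_rng
  isOpenMap V hV := by
    have hpre : ofTuple ⁻¹' (ofTuple '' V) = ⋃ e : Equiv.Perm (Fin n), (fun x => x ∘ e) ⁻¹' V := by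
      ext x
      simp [eq_comm (b := ofTuple x), ofTuple_eq_iff]
    rw [isOpen_coinduced, hpre]
    exact isOpen_iUnion fun e => hV.preimage (by fun_prop)

end RealDivisor

/-- The ordered version of `DivisorCollection`. -/
abbrev TupleCollection (n m : ℕ) : Type :=
  {u : Fin (m + 1) → Fin n → ℝ // ⋂ p, (RealDivisor.ofTuple (u p)).support = ∅}

/-- The colour and the place of the `j.2`-th point of the `j.1`-th tuple. -/
def particles {n m : ℕ} (u : Fin (m + 1) → Fin n → ℝ) (j : Fin (m + 1) × Fin n) :
    Fin (m + 1) × ℝ :=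
  (j.1, u j.1 j.2)

namespace ParticleSpace

open RealDivisor

variable {n m : ℕ}

/-- The configuration of mod 2 particles that is represented by a collection of tuples. -/
def ofTuples (u : TupleCollection n m) : ParticleSpace n m :=
  Quotient.mk _ ⟨fun p => ofTuple (u.1 p), u.2⟩

lemma isQuotientMap_ofTuples : IsQuotientMap (ofTuples (n := n) (m := m)) := by
  have hpi : IsOpenQuotientMap (Pi.map fun _ : Fin (m + 1) => ofTuple (n := n)) :=
    IsOpenQuotientMap.piMap fun _ => isOpenQuotientMap_ofTuple
  let S : Set (Fin (m + 1) → RealDivisor n) := {D | ⋂ p, (D p).support = ∅}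
  have hrestrict : IsOpenQuotientMap (S.restrictPreimage (Pi.map fun _ => ofTuple)) :=
    ⟨Set.restrictPreimage_surjective S hpi.surjective, hpi.continuous.restrictPreimage,
      hpi.isOpenMap.restrictPreimage S⟩
  exact IsQuotientMap.comp (isQuotientMap_quotient_mk' (s := mod2Setoid n m))
    hrestrict.isQuotientMap

/-- The multiplicity modulo `2` of a place in the divisor of a colour; these multiplicities
determine a configuration. -/
noncomputable def mod2Mult (ξ : ParticleSpace n m) (y : Fin (m + 1) × ℝ) : ZMod 2 :=
  Quotient.liftOn ξ (fun D => ((D.1 y.1).mult y.2 : ZMod 2)) fun _ _ h =>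
    (ZMod.natCast_eq_natCast_iff _ _ 2).2 (h y.1 y.2)

lemma mod2Mult_injective : Function.Injective (mod2Mult (n := n) (m := m)) := by
  intro ξ η h
  induction ξ, η using Quotient.inductionOn₂ with
  | h D E =>
    exact Quotient.sound fun p w => (ZMod.natCast_eq_natCast_iff _ _ 2).1 (congr_fun h (p, w))

lemma mod2Mult_ofTuples (u : TupleCollection n m) :
    (ofTuples u).mod2Mult = mod2Count univ (particles u.1) := by
  funext ⟨p, w⟩
  change ((ofTuple (u.1 p)).mult w : ZMod 2) = _
  rw [mult_ofTuple, mod2Count_eq_sum, Fintype.sum_prod_type, sum_eq_single p]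
  · simp [particles]
  · intro r _ hr
    simp [particles, hr]
  · simp

lemma iInter_support_eq_empty_iff {u : Fin 2 → Fin n → ℝ} :
    ⋂ p, (ofTuple (u p)).support = ∅ ↔
      ∀ j k : Fin 2 × Fin n, j.1 ≠ k.1 → u j.1 j.2 ≠ u k.1 k.2 := by
  simp only [Set.eq_empty_iff_forall_notMem, Set.mem_iInter, mem_support_ofTuple, not_forall,
    not_exists, Prod.forall]
  constructor
  · intro h p i r j hpr heq
    obtain ⟨k, hk⟩ := h (u p i)
    rcases (show k = p ∨ k = r by omega) with rfl | rfl
    · exact hk i rfl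
    · exact hk j heq.symm
  · intro h w
    by_contra! hw
    obtain ⟨i, hi⟩ := hw 0
    obtain ⟨j, hj⟩ := hw 1
    exact h 0 i 1 j zero_ne_one (hi.trans hj.symm)

lemma isOpen_setOf_iInter_support_eq_empty :
    IsOpen {u : Fin 2 → Fin n → ℝ | ⋂ p, (ofTuple (u p)).support = ∅} := by
  simp only [iInter_support_eq_empty_iff, Set.ofPred_forall]
  exact isOpen_iInter_of_finite fun j => isOpen_iInter_of_finite fun k =>
    isOpen_iInter_of_finite fun _ => isOpen_ne_fun (by fun_prop) (by fun_prop)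

lemma mod2Count_particles_ite_mem {v : Fin (m + 1) → Fin n → ℝ} {G : Finset (Fin (m + 1) × Fin n)}
    (hG : mod2Count G (particles v) = 0) (far : Fin (m + 1) → ℝ) :
    mod2Count univ (particles fun p i => if (p, i) ∈ G then far p else v p i) =
      mod2Count univ (particles v) := by
  refine mod2Count_univ_eq_of_eq_zero ?_ hG fun j hj => by simp [particles, hj]
  rw [← mod2Count_comp_eq_zero hG fun y => (y.1, far y.1)]
  exact mod2Count_congr fun j hj => by simp [particles, hj]

lemma exists_continuousWithinAt_mod2Mult_eq {X : Type*} [TopologicalSpace X]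
    {f : X → Fin 2 → Fin n → ℝ} {s : Set X} {z₀ : X} (hf : ContinuousWithinAt f s z₀)
    {G : Finset (Fin 2 × Fin n)} (hG : ∀ᶠ z in 𝓝[s] z₀, mod2Count G (particles (f z)) = 0)
    (hne : ∀ j ∉ G, ∀ k ∉ G, j.1 ≠ k.1 → f z₀ j.1 j.2 ≠ f z₀ k.1 k.2) :
    ∃ F : X → ParticleSpace n 1, ContinuousWithinAt F s z₀ ∧
      ∀ᶠ z in 𝓝[s] z₀, (F z).mod2Mult = mod2Count univ (particles (f z)) := by
  obtain ⟨M, hM⟩ := (Set.finite_range fun j : Fin 2 × Fin n => f z₀ j.1 j.2).bddAbove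
  have hM (j : Fin 2 × Fin n) : f z₀ j.1 j.2 ≤ M := hM ⟨j, rfl⟩
  -- Parking the cancelling particles far away does not change the configuration mod 2.
  let far (p : Fin 2) : ℝ := M + 1 + (p : ℕ)
  let g (z : X) (p : Fin 2) (i : Fin n) : ℝ := if (p, i) ∈ G then far p else f z p i
  have hg : ContinuousWithinAt g s z₀ := by
    refine continuousWithinAt_pi.2 fun p => continuousWithinAt_pi.2 fun i => ?_
    by_cases hpi : (p, i) ∈ G
    · simpa only [g, if_pos hpi] using continuousWithinAt_const
    · simpa only [g, if_neg hpi] using continuousWithinAt_pi.1 (continuousWithinAt_pi.1 hf p) i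
  have hg₀ : ⋂ p, (ofTuple (g z₀ p)).support = ∅ := by
    refine iInter_support_eq_empty_iff.2 fun j k hjk => ?_
    have (p : Fin 2) : M < far p := by linarith [(p : ℕ).cast_nonneg (α := ℝ)]
    have hinj : far j.1 ≠ far k.1 := by simpa [far, Fin.ext_iff] using hjk
    grind
  have hopen := isOpen_setOf_iInter_support_eq_empty (n := n)
  let Q : (Fin 2 → Fin n → ℝ) → ParticleSpace n 1 :=
    Function.extend Subtype.val ofTuples fun _ => ofTuples ⟨g z₀, hg₀⟩
  have hQ (u : TupleCollection n 1) : Q u.1 = ofTuples u :=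
    Subtype.val_injective.extend_apply _ _ u
  have hQ₀ : ContinuousAt Q (g z₀) := by
    refine (hopen.isOpenEmbedding_subtypeVal.continuousAt_iff (x := ⟨g z₀, hg₀⟩)).1 ?_
    exact (funext hQ : Q ∘ Subtype.val = ofTuples) ▸ isQuotientMap_ofTuples.continuous.continuousAt
  refine ⟨Q ∘ g, hQ₀.comp_continuousWithinAt hg, ?_⟩
  filter_upwards [hG, hg (hopen.mem_nhds hg₀)] with z hGz hgz
  rw [Function.comp_apply, hQ ⟨g z, hgz⟩, mod2Mult_ofTuples]
  exact mod2Count_particles_ite_mem hGz far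

end ParticleSpace

/-- An order in which the entries of a pair of `n`-tuples are listed. -/
abbrev Enumeration (n : ℕ) : Type := Fin (2 * n) ≃ Fin 2 × Fin n

namespace Enumeration

variable {n : ℕ}

/-- The place in the list of an entry of a pair of tuples. -/
def index (π : Enumeration n) : Fin 2 × Fin n ↪ ℕ := π.symm.toEmbedding.trans Fin.valEmbedding

/-- The colours of the listed entries; colours beyond the end of the list are irrelevant. -/
noncomputable def word (π : Enumeration n) : ParticleWord := Function.extend π.index Prod.fst 0

/-- The values of the listed entries, followed by irrelevant values. -/
noncomputable def place (π : Enumeration n) (u : Fin 2 → Fin n → ℝ) : ℕ → ℝ :=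
  Function.extend π.index (fun j => u j.1 j.2) 0

/-- The list of the entries is weakly increasing. -/
def Sorts (π : Enumeration n) (u : Fin 2 → Fin n → ℝ) : Prop :=
  ∀ j k, π.index j ≤ π.index k → u j.1 j.2 ≤ u k.1 k.2

variable (π : Enumeration n) {u : Fin 2 → Fin n → ℝ}

lemma word_index (j : Fin 2 × Fin n) : π.word (π.index j) = j.1 := π.index.injective.extend_apply ..

lemma place_index (u : Fin 2 → Fin n → ℝ) (j : Fin 2 × Fin n) :
    π.place u (π.index j) = u j.1 j.2 :=
  π.index.injective.extend_apply ..

lemma map_index_univ : univ.map π.index = range (2 * n) := by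
  rw [index, ← map_map, map_univ_equiv, Fin.map_valEmbedding_univ, Nat.Iio_eq_range]

lemma mem_range_index {q : ℕ} : q < 2 * n ↔ ∃ j, π.index j = q := by
  rw [← mem_range, ← π.map_index_univ]
  simp

lemma exists_sorts (u : Fin 2 → Fin n → ℝ) : ∃ π : Enumeration n, π.Sorts u := by
  let f : Fin (2 * n) → ℝ := (fun j => u j.1 j.2) ∘ finProdFinEquiv.symm
  let π : Enumeration n := (Tuple.sort f).trans finProdFinEquiv.symm
  have hf (j : Fin 2 × Fin n) : f (Tuple.sort f (π.symm j)) = u j.1 j.2 :=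
    congrArg (fun k : Fin 2 × Fin n => u k.1 k.2) (π.apply_symm_apply j)
  exact ⟨π, fun j k hjk => hf j ▸ hf k ▸ Tuple.monotone_sort f hjk⟩

lemma isClosed_setOf_sorts : IsClosed {u | π.Sorts u} := by
  simp only [Sorts, Set.ofPred_forall]
  exact isClosed_iInter fun j => isClosed_iInter fun k => isClosed_iInter fun _ =>
    isClosed_le (by fun_prop) (by fun_prop)

lemma continuous_place (q : ℕ) : Continuous fun u => π.place u q := by
  by_cases hq : ∃ j, π.index j = q
  · obtain ⟨j, rfl⟩ := hq
    simp only [place_index]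
    fun_prop
  · simpa only [place, Function.extend_apply' _ _ _ hq] using continuous_const

lemma continuous_gapLength (e : ℤ) (i : ℕ) :
    Continuous fun u => π.word.gapLength (π.place u) (2 * n) e i := by
  refine continuous_finsetSum _ fun q _ => ?_
  split_ifs
  · exact (π.continuous_place _).sub (π.continuous_place _)
  · exact continuous_const

variable {π} in
lemma Sorts.sorted_word (hu : π.Sorts u)
    (hdisj : ⋂ p, (RealDivisor.ofTuple (u p)).support = ∅) :
    π.word.Sorted (π.place u) (2 * n) := by
  have hmono (a b : ℕ) (hab : a ≤ b) (hb : b < 2 * n) : π.place u a ≤ π.place u b := by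
    obtain ⟨j, rfl⟩ := π.mem_range_index.1 (hab.trans_lt hb)
    obtain ⟨k, rfl⟩ := π.mem_range_index.1 hb
    simpa only [place_index] using hu j k hab
  refine ⟨hmono, fun a b hab hb hc => (hmono a b hab.le hb).lt_of_ne ?_⟩
  obtain ⟨j, rfl⟩ := π.mem_range_index.1 (hab.trans hb)
  obtain ⟨k, rfl⟩ := π.mem_range_index.1 hb
  rw [word_index, word_index] at hc
  rw [place_index, place_index]
  exact ParticleSpace.iInter_support_eq_empty_iff.1 hdisj j k hc

/-- The pair of tuples whose listed entries are given. -/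
def arrange (z : ℕ → ℝ) (p : Fin 2) (i : Fin n) : ℝ := z (π.index (p, i))

lemma mod2Count_particles_arrange (S : Finset (Fin 2 × Fin n)) (z : ℕ → ℝ) :
    mod2Count S (particles (π.arrange z)) =
      mod2Count (S.map π.index) fun q => (π.word q, z q) := by
  rw [mod2Count_map]
  exact mod2Count_congr fun j _ => by simp [particles, arrange, word_index]

lemma mod2Count_univ_particles_arrange (z : ℕ → ℝ) :
    mod2Count univ (particles (π.arrange z)) =
      mod2Count (range (2 * n)) fun q => (π.word q, z q) := by
  rw [mod2Count_particles_arrange, map_index_univ]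

lemma arrange_place (u : Fin 2 → Fin n → ℝ) : π.arrange (π.place u) = u := by
  funext p i
  exact π.place_index u (p, i)

end Enumeration

/-- The time for closing the gaps: it runs from `0` to `∞` during the first half of `I`. -/
noncomputable def gapTime (τ : I) : ℝ≥0∞ := (ENNReal.ofReal (1 - 2 * τ))⁻¹ - 1

/-- The time for moving to the final places: it runs from `0` to `1` during the second half
of `I`. -/
noncomputable def lineTime (τ : I) : ℝ := max (2 * τ - 1) 0

lemma continuous_gapTime : Continuous gapTime :=
  (ENNReal.continuous_sub_right 1).comp
    (continuous_inv.comp (ENNReal.continuous_ofReal.comp (by fun_prop)))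

lemma continuous_lineTime : Continuous lineTime := by unfold lineTime; fun_prop

lemma gapTime_zero : gapTime 0 = 0 := by simp [gapTime]

lemma lineTime_zero : lineTime 0 = 0 := by simp [lineTime]

lemma lineTime_one : lineTime 1 = 1 := by norm_num [lineTime]

lemma lineTime_nonneg (τ : I) : 0 ≤ lineTime τ := le_max_right _ _

lemma lineTime_le_one (τ : I) : lineTime τ ≤ 1 := max_le (by linarith [τ.2.2]) zero_le_one

lemma lineTime_eq_zero_or_gapTime_eq_top (τ : I) : lineTime τ = 0 ∨ gapTime τ = ⊤ := by
  rcases le_total (2 * (τ : ℝ)) 1 with h | h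
  · exact .inl (max_eq_right (by linarith))
  · refine .inr ?_
    rw [gapTime, ENNReal.ofReal_of_nonpos (by linarith), ENNReal.inv_zero,
      ENNReal.top_sub ENNReal.one_ne_top]

namespace Enumeration

variable {n : ℕ} (π : Enumeration n)

/-- The pair of tuples that `u` has become at time `τ`, for `u` sorted by `π`. -/
noncomputable def motion (u : Fin 2 → Fin n → ℝ) (τ : I) : Fin 2 → Fin n → ℝ :=
  π.arrange (π.word.moved (π.place u) (2 * n) (gapTime τ) (lineTime τ))

lemma continuous_motion :
    Continuous fun y : (Fin 2 → Fin n → ℝ) × I => π.motion y.1 y.2 := by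
  refine continuous_pi fun p => continuous_pi fun i => ?_
  have hplace := (π.continuous_place (π.index (p, i))).comp (continuous_fst (Y := I))
  have hgap := (π.continuous_gapLength (π.word.edge (π.index (p, i))) (π.index (p, i))).comp
    (continuous_fst (Y := I))
  have htravel := continuous_travel.comp
    ((continuous_gapTime.comp continuous_snd).prodMk hgap)
  have hline := continuous_lineTime.comp (continuous_snd (X := Fin 2 → Fin n → ℝ))
  exact ((continuous_const.sub hline).mul (hplace.add htravel)).add (hline.mul continuous_const)

lemma motion_zero (u : Fin 2 → Fin n → ℝ) : π.motion u 0 = u := by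
  simp only [motion, gapTime_zero, lineTime_zero, ParticleWord.moved_zero_zero, arrange_place]

lemma motion_one (u v : Fin 2 → Fin n → ℝ) : π.motion u 1 = π.motion v 1 := by
  simp only [motion, lineTime_one, ParticleWord.moved_one]

end Enumeration

namespace ParticleSpace

open Enumeration

variable {n : ℕ} (π : Enumeration n)

lemma exists_continuousWithinAt_mod2Mult_eq_motion {y₀ : TupleCollection n 1 × I}
    (hy₀ : π.Sorts y₀.1.1) :
    ∃ F : TupleCollection n 1 × I → ParticleSpace n 1,
      ContinuousWithinAt F {y | π.Sorts y.1.1} y₀ ∧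
      ∀ᶠ y in 𝓝[{y | π.Sorts y.1.1}] y₀,
        (F y).mod2Mult = mod2Count univ (particles (π.motion y.1.1 y.2)) := by
  classical
  let gap (y : TupleCollection n 1 × I) (q a : ℕ) : ℝ :=
    π.word.gapLength (π.place y.1.1) (2 * n) (π.word.edge q) a
  have hgap (q a : ℕ) : Continuous fun y => gap y q a :=
    (π.continuous_gapLength _ _).comp (continuous_subtype_val.comp continuous_fst)
  have hnear : ∀ᶠ y in 𝓝 y₀, ∀ q ∈ range (2 * n), ∀ a ∈ range (2 * n),
      ENNReal.ofReal (gap y₀ q a) < gapTime y₀.2 → ENNReal.ofReal (gap y q a) ≤ gapTime y.2 := by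
    simp only [Filter.eventually_all_finset, Filter.eventually_imp_distrib_left]
    intro q _ a _ hlt
    exact ((ENNReal.continuous_ofReal.comp (hgap q a)).continuousAt.eventually_lt
      (continuous_gapTime.comp continuous_snd).continuousAt hlt).mono fun _ => le_of_lt
  refine exists_continuousWithinAt_mod2Mult_eq (π.continuous_motion.comp
      ((continuous_subtype_val.comp continuous_fst).prodMk continuous_snd)).continuousWithinAt
    (G := {j | π.word.Cancelled (π.place y₀.1.1) (2 * n) (gapTime y₀.2)
      (π.word.edge (π.index j)) (π.index j)}) ?_ fun j hj k hk hjk => ?_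
  · filter_upwards [nhdsWithin_le_nhds hnear, self_mem_nhdsWithin] with y hy hsorts
    refine (π.mod2Count_particles_arrange _ _).trans <|
      (hsorts.sorted_word y.1.2).mod2Count_moved_eq_zero (fun q hq a ha =>
        hy q (mem_range.2 hq) a (mem_range.2 ha)) fun q => ?_
    rw [mem_map, π.mem_range_index]
    grind
  · refine (hy₀.sorted_word y₀.1.2).moved_ne (lineTime_nonneg _) (lineTime_le_one _)
      (lineTime_eq_zero_or_gapTime_eq_top _) (π.mem_range_index.2 ⟨j, rfl⟩)
      (π.mem_range_index.2 ⟨k, rfl⟩) ?_ (by simpa using hj) (by simpa using hk)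
    rwa [word_index, word_index]

lemma mod2Count_motion_eq {π π' : Enumeration n} {u v : TupleCollection n 1} (hu : π.Sorts u.1)
    (hv : π'.Sorts v.1) (huv : ofTuples u = ofTuples v) (τ : I) :
    mod2Count univ (particles (π.motion u.1 τ)) =
      mod2Count univ (particles (π'.motion v.1 τ)) := by
  have hp : mod2Count univ (particles u.1) = mod2Count univ (particles v.1) := by
    rw [← mod2Mult_ofTuples, huv, mod2Mult_ofTuples]
  rw [← π.arrange_place u.1, ← π'.arrange_place v.1, mod2Count_univ_particles_arrange,
    mod2Count_univ_particles_arrange] at hp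
  rw [motion, motion, mod2Count_univ_particles_arrange, mod2Count_univ_particles_arrange]
  exact (hu.sorted_word u.2).mod2Count_moved_eq (hv.sorted_word v.2) hp _ _

lemma exists_mod2Mult_eq_motion (ξ : ParticleSpace n 1) (τ : I) :
    ∃ η : ParticleSpace n 1, ∀ (π : Enumeration n) (u : TupleCollection n 1), π.Sorts u.1 →
      ofTuples u = ξ → η.mod2Mult = mod2Count univ (particles (π.motion u.1 τ)) := by
  obtain ⟨v, rfl⟩ := isQuotientMap_ofTuples.surjective ξ
  obtain ⟨π', hv⟩ := exists_sorts v.1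
  obtain ⟨F, -, hF⟩ := exists_continuousWithinAt_mod2Mult_eq_motion π' (y₀ := (v, τ)) hv
  refine ⟨F (v, τ), fun π u hu huv => ?_⟩
  rw [hF.self_of_nhdsWithin hv, mod2Count_motion_eq hu hv huv]

/-- The configuration that `ξ` has become at time `τ`. -/
noncomputable def homotopy (ξ : ParticleSpace n 1) (τ : I) : ParticleSpace n 1 :=
  (exists_mod2Mult_eq_motion ξ τ).choose

variable {π}

lemma mod2Mult_homotopy_ofTuples {u : TupleCollection n 1} (hu : π.Sorts u.1) (τ : I) :
    (homotopy (ofTuples u) τ).mod2Mult = mod2Count univ (particles (π.motion u.1 τ)) :=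
  (exists_mod2Mult_eq_motion (ofTuples u) τ).choose_spec π u hu rfl

lemma homotopy_zero (ξ : ParticleSpace n 1) : homotopy ξ 0 = ξ := by
  obtain ⟨u, rfl⟩ := isQuotientMap_ofTuples.surjective ξ
  obtain ⟨π, hu⟩ := exists_sorts u.1
  apply mod2Mult_injective
  rw [mod2Mult_homotopy_ofTuples hu, motion_zero, mod2Mult_ofTuples]

lemma continuous_homotopy : Continuous fun y : ParticleSpace n 1 × I => homotopy y.1 y.2 := by
  have hclosed (π : Enumeration n) : IsClosed {y : TupleCollection n 1 × I | π.Sorts y.1.1} :=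
    π.isClosed_setOf_sorts.preimage (continuous_subtype_val.comp continuous_fst)
  refine isQuotientMap_ofTuples.continuous_lift_prod_left <|
    (locallyFinite_of_finite _).continuous
      (Set.iUnion_eq_univ_iff.2 fun y => exists_sorts y.1.1) hclosed fun π y₀ hy₀ => ?_
  obtain ⟨F, hF, heq⟩ := exists_continuousWithinAt_mod2Mult_eq_motion π hy₀
  refine hF.congr_of_eventuallyEq_of_mem ?_ hy₀
  filter_upwards [heq, self_mem_nhdsWithin] with y hy hsorts
  exact mod2Mult_injective ((mod2Mult_homotopy_ofTuples hsorts y.2).trans hy.symm)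

lemma isLocallyConstant_homotopy_one :
    IsLocallyConstant fun ξ : ParticleSpace n 1 => homotopy ξ 1 := by
  have htuples : IsLocallyConstant fun u : TupleCollection n 1 => homotopy (ofTuples u) 1 := by
    refine isLocallyConstant_of_finite_isClosed_cover
      (Set.iUnion_eq_univ_iff.2 fun u => exists_sorts u.1)
      (fun π => π.isClosed_setOf_sorts.preimage continuous_subtype_val)
      fun π u hu v hv => mod2Mult_injective ?_
    rw [mod2Mult_homotopy_ofTuples hu, mod2Mult_homotopy_ofTuples hv, π.motion_one u.1 v.1]
  exact fun s => isQuotientMap_ofTuples.isOpen_preimage.1 (htuples s)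

end ParticleSpace

open ParticleSpace in
theorem mainTheorem7 (n : ℕ) (ξ : ParticleSpace n 1) :
    ContractibleSpace (connectedComponent ξ) :=
  contractibleSpace_connectedComponent_of_isLocallyConstant continuous_homotopy homotopy_zero
    isLocallyConstant_homotopy_one ξ
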